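/- For $n,k\in\mathbb N$ let $S^n_k=\{\gamma<\omega_n : \operatorname{cf}\gamma=\omega_k\}$. A set $S\subseteq\omega_3$ *reflects at* $\gamma<\omega_3$ if $S\cap\gamma$ is a stationary subset of $\gamma$. For stationary sets $S,A\subseteq\omega_3$, $S$ *reflects fully in* $A$, written $S<A$, if $S$ reflects at almost all $\gamma\in A$, that is, if $\{\gamma\in A : S\text{ does not reflect at }\gamma\}$ is a nonstationary subset of $\omega_3$. **Proposition 3.1.** For every family $\langle A_\alpha : \alpha<\omega_3\rangle$ of stationary subsets of $\omega_3$ with $A_\alpha\subseteq S^3_1$ for all $\alpha<\omega_3$, there exists a stationary set $S\subseteq S^3_0$ such that $S\not< A_\alpha$ for all $\alpha<\omega_3$. -/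

import Mathlib

open scoped Ordinal Cardinal

universe u

namespace StationaryReflection

/-- `S ∩ γ` is a stationary subset of the ordinal `γ`, i.e. it meets every closed unbounded subset
of `γ`; here `γ` is identified with the well-order `Set.Iio γ` of the ordinals below it. -/
def StationaryIn (γ : Ordinal.{u}) (S : Set Ordinal.{u}) : Prop :=
  IsStationary {x : Set.Iio γ | (x : Ordinal.{u}) ∈ S}

/-- `S` reflects at `γ`: the set `S ∩ γ` is a stationary subset of `γ`. -/
def ReflectsAt (S : Set Ordinal.{u}) (γ : Ordinal.{u}) : Prop :=
  StationaryIn γ S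

/-- `S < A` (for stationary `S, A ⊆ κ`): `S` reflects at almost all elements of `A`, i.e. the set of
exceptions is a nonstationary subset of `κ`. -/
def ReflectsFullyIn (κ : Ordinal.{u}) (S A : Set Ordinal.{u}) : Prop :=
  ¬ StationaryIn κ {γ | γ ∈ A ∧ ¬ ReflectsAt S γ}

/-- The set `S^n_k` of all ordinals below `ω_n` of cofinality `ω_k`. -/
def cofSet (n k : ℕ) : Set Ordinal.{u} :=
  {γ | γ < ω_ (n : Ordinal.{u}) ∧ γ.cof = ℵ_ (k : Ordinal.{u})}

end StationaryReflection

/-!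
The argument is a count and uses no square principle. Write `κ = ω₂`, `κ⁺ = ω₃`.

There is a family `F` of more than `κ⁺` functions `f : κ⁺ → κ⁺`, any two of which differ from some
point on (`exists_pairwise_eventually_ne`). Fix for every `δ < κ⁺` of countable cofinality a cofinal
sequence `d δ : ℕ → δ`, and for every `δ < κ⁺` a map `h δ` to `κ` that is injective below `δ`. For
`f ∈ F` and `i < κ`, consider the `δ` of countable cofinality for which all the values `f (d δ n)`
lie below `δ` and have `h δ`-index below `i`. As `cf κ > ω`, the union of these sets over `i < κ`
contains all `δ` of countable cofinality closed under `f`, so for some `i = i f` the set is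
stationary (`exists_isStationary_bounded`); call it `S f`.

If every `S f` reflected fully in some `A α`, then the pigeonhole principle would give `κ` many
functions `f ∈ N ⊆ F` with the same `α` and the same bound `i f = j`. Pick `β` beyond which any two
of them differ, and `γ ∈ A α` above `β` at which all the sets `S f`, `f ∈ N`, reflect. As
`cf γ = ω₁`, there is a club `c` in `γ` of size `ω₁` (`exists_isClub_mk_le_cof`), and every `S f`
contains some `δ f ∈ c` above `β`. Evaluating `f` at a term of `d (δ f)` above `β` shows that `f` is
determined by `δ f ∈ c` and an index below `j`. That leaves fewer than `κ` functions, a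
contradiction.
-/

namespace StationaryReflection

open Set Order

/-! ### Eventually different functions -/

/-- A maximal eventually different family of functions `α → α` has more than `#α` members: a family
indexed by `α` can be diagonalized against, avoiding at `x` the values of the functions with index
at most `x`. -/
theorem exists_pairwise_eventually_ne {α : Type*} [LinearOrder α] [Nonempty α]
    (hα : ∀ x : α, #(Iic x) < #α) :
    ∃ F : Set (α → α), #α < #F ∧
      F.Pairwise fun f g ↦ ∃ b, ∀ x, b ≤ x → f x ≠ g x := by
  obtain ⟨F, hF⟩ := zorn_subset
    {F : Set (α → α) | F.Pairwise fun f g ↦ ∃ b, ∀ x, b ≤ x → f x ≠ g x} fun c hc hchain ↦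
      ⟨⋃₀ c, (pairwise_sUnion hchain.directedOn).2 fun s hs ↦ hc hs,
        fun s ↦ subset_sUnion_of_mem⟩
  refine ⟨F, ?_, hF.prop⟩
  by_contra! hle
  obtain ⟨j⟩ := hle
  have hg (x : α) : ∃ y, ∀ f : F, j f ≤ x → f.1 x ≠ y := by
    by_contra! h
    choose e he hex using h
    refine (hα x).not_ge (Cardinal.mk_le_of_injective (f := fun y ↦ (⟨j (e y), he y⟩ : Iic x)) ?_)
    intro y y' hyy
    rw [← hex y, ← hex y', j.injective (Subtype.ext_iff.1 hyy)]
  choose g hg using hg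
  have hgF : g ∈ F := by
    refine hF.mem_of_prop_insert (pairwise_insert.2 ⟨hF.prop, fun f hf _ ↦ ?_⟩)
    exact ⟨⟨j ⟨f, hf⟩, fun x hx ↦ (hg x ⟨f, hf⟩ hx).symm⟩, ⟨j ⟨f, hf⟩, fun x hx ↦ hg x ⟨f, hf⟩ hx⟩⟩
  exact hg _ ⟨g, hgF⟩ le_rfl rfl

/-! ### Clubs and stationary sets -/

theorem exists_forall_lt_of_mk_lt_cof {α : Type*} [LinearOrder α] {s : Set α}
    (hs : #s < cof α) : ∃ b, ∀ x ∈ s, x < b := by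
  simpa [not_isCofinal_iff] using fun h : IsCofinal s ↦ (cof_le h).not_gt hs

/-- The witness is the closure of a cofinal set `s` of minimal size. Mapping a point of it to the
least element of `s` above it is strictly monotone, so the closure is no larger than `s`. -/
theorem exists_isClub_mk_le_cof (α : Type*) [LinearOrder α] [WellFoundedLT α] [NoMaxOrder α] :
    ∃ c : Set α, IsClub c ∧ #c ≤ cof α := by
  obtain ⟨s, hs, hcard⟩ := exists_cof_eq (α := α)
  refine ⟨{x | ∀ y < x, ∃ z ∈ s, y < z ∧ z ≤ x}, ⟨?_, fun x ↦ ?_⟩, ?_⟩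
  · intro d hd _ _ a ha y hy
    obtain ⟨x, hx, hyx⟩ := (lt_isLUB_iff ha).1 hy
    obtain ⟨z, hz, hyz, hzx⟩ := hd hx y hyx
    exact ⟨z, hz, hyz, hzx.trans (ha.1 hx)⟩
  · obtain ⟨z, hz, hxz⟩ := hs x
    exact ⟨z, fun y hy ↦ ⟨z, hz, hy, le_rfl⟩, hxz⟩
  · have hne (x : α) : (s ∩ Ioi x).Nonempty := by
      obtain ⟨y, hy⟩ := exists_gt x
      obtain ⟨z, hz, hyz⟩ := hs y
      exact ⟨z, hz, hy.trans_le hyz⟩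
    let m (x : α) : α := wellFounded_lt.min (s ∩ Ioi x) (hne x)
    have hm (x : α) : m x ∈ s ∩ Ioi x := wellFounded_lt.min_mem _ _
    rw [← hcard]
    have hmono : StrictMono fun x : {x | ∀ y < x, ∃ z ∈ s, y < z ∧ z ≤ x} ↦
        (⟨m x, (hm x).1⟩ : s) := by
      intro x y hxy
      obtain ⟨z, hz, hxz, hzy⟩ := y.2 x hxy
      have hmz : m x ≤ z := not_lt.1 (wellFounded_lt.not_lt_min (s ∩ Ioi x.1) ⟨hz, hxz⟩)
      exact hmz.trans_lt (hzy.trans_lt (hm y).2)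
    exact Cardinal.mk_le_of_injective hmono.injective

theorem isClub_Ioi {α : Type*} [LinearOrder α] [NoMaxOrder α] (b : α) : IsClub (Ioi b) := by
  refine ⟨fun d hd ⟨x, hx⟩ _ a ha ↦ (hd hx).trans_le (ha.1 hx), fun x ↦ ?_⟩
  obtain ⟨y, hy⟩ := exists_gt (max x b)
  exact ⟨y, (le_max_right _ _).trans_lt hy, (le_max_left _ _).trans hy.le⟩

/-- A given club contains the supremum of an increasing sequence of its points, each chosen above
the values of `f` up to the previous one. -/
theorem isStationary_cof_aleph0_closed {o : Ordinal.{u}} (ho : ℵ₀ < cof (Iio o))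
    (hlt : ∀ x : Iio o, #(Iic x) < cof (Iio o)) (f : Iio o → Iio o) :
    IsStationary {δ : Iio o | (δ : Ordinal).cof = ℵ₀ ∧ ∀ x < δ, f x < δ} := by
  intro t ht
  have hg (x : Iio o) : ∃ y ∈ t, x < y ∧ ∀ z ≤ x, f z < y := by
    obtain ⟨b, hb⟩ := exists_forall_lt_of_mk_lt_cof (s := f '' Iic x)
      (Cardinal.mk_image_le.trans_lt (hlt x))
    obtain ⟨b', hb'⟩ := exists_forall_lt_of_mk_lt_cof (s := {x})
      (by simpa using Cardinal.one_lt_aleph0.trans ho)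
    obtain ⟨y, hy, hby⟩ := ht.isCofinal (max b b')
    exact ⟨y, hy, (hb' x rfl).trans_le ((le_max_right _ _).trans hby),
      fun z hz ↦ (hb _ (mem_image_of_mem f hz)).trans_le ((le_max_left _ _).trans hby)⟩
  choose g hgt hxg hfg using hg
  have hne : Nonempty (Iio o) := cof_ne_zero_iff.1 (Cardinal.aleph0_pos.trans ho).ne'
  let v (n : ℕ) : Iio o := g^[n + 1] hne.some
  have hv (n : ℕ) : v (n + 1) = g (v n) := Function.iterate_succ_apply' ..
  have hvt (n : ℕ) : v n ∈ t := by
    simp only [v, Function.iterate_succ_apply']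
    exact hgt _
  have hmono : StrictMono v := strictMono_nat_of_lt_succ fun n ↦ by
    rw [hv]
    exact hxg _
  obtain ⟨b, hb⟩ := exists_forall_lt_of_mk_lt_cof (s := range v)
    ((Cardinal.le_aleph0_iff_set_countable.2 (countable_range v)).trans_lt ho)
  have hδ : ⨆ n, (v n : Ordinal) < o :=
    (Ordinal.iSup_le fun n ↦ (hb _ ⟨n, rfl⟩).le).trans_lt b.2
  have hlub : IsLUB (range v) ⟨_, hδ⟩ := by
    refine ⟨?_, fun c hc ↦ Ordinal.iSup_le fun n ↦ hc ⟨n, rfl⟩⟩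
    rintro _ ⟨n, rfl⟩
    exact Ordinal.le_iSup (fun n ↦ (v n : Ordinal)) n
  refine ⟨⟨_, hδ⟩, ⟨?_, fun x hx ↦ ?_⟩, ht.isLUB_mem (range_subset_iff.2 hvt) ⟨_, 0, rfl⟩ hlub⟩
  · simpa using Ordinal.lift_cof_iSup (f := fun n ↦ (v n : Ordinal)) hmono
  · obtain ⟨_, ⟨n, rfl⟩, hn⟩ := (lt_isLUB_iff hlub).1 hx
    exact ((hfg _ _ hn.le).trans_eq (hv n).symm).trans_le (hlub.1 ⟨_, rfl⟩)

theorem exists_seq_of_cof_eq_aleph0 {δ : Ordinal.{u}} (hδ : δ.cof = ℵ₀) :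
    ∃ d : ℕ → Ordinal.{u}, (∀ n, d n < δ) ∧ ∀ b < δ, ∃ n, b ≤ d n := by
  obtain ⟨s, hs, hcard⟩ := exists_cof_eq (α := Iio δ)
  rw [Ordinal.cof_Iio, ← Ordinal.lift_cof, hδ, Cardinal.lift_aleph0] at hcard
  have hne : Nonempty s := Cardinal.mk_ne_zero_iff.1 (hcard ▸ Cardinal.aleph0_ne_zero)
  have hcount : Countable s := Cardinal.mk_le_aleph0_iff.1 hcard.le
  obtain ⟨e, he⟩ := exists_surjective_nat s
  refine ⟨fun n ↦ (e n).1.1, fun n ↦ (e n).1.2, fun b hb ↦ ?_⟩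
  obtain ⟨x, hx, hbx⟩ := hs ⟨b, hb⟩
  obtain ⟨n, hn⟩ := he ⟨x, hx⟩
  exact ⟨n, by simpa only [hn] using show b ≤ x.1 from hbx⟩

/-! ### Initial segments of regular cardinals -/

theorem noMaxOrder_of_aleph0_le_cof {α : Type*} [LinearOrder α] (h : ℵ₀ ≤ cof α) :
    NoMaxOrder α := by
  rw [← noTopOrder_iff_noMaxOrder, ← cof_ne_one_iff]
  exact (Cardinal.one_lt_aleph0.trans_le h).ne'

theorem cof_Iio_ord {κ : Cardinal.{u}} (hκ : κ.IsRegular) :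
    cof (Iio κ.ord) = Cardinal.lift.{u + 1} κ := by
  rw [Ordinal.cof_Iio, ← Ordinal.lift_cof, hκ.cof_ord]

theorem mk_Iio_ord (κ : Cardinal.{u}) : #(Iio κ.ord) = Cardinal.lift.{u + 1} κ := by
  rw [Cardinal.mk_Iio_ordinal, Cardinal.card_ord]

theorem mk_Iio_subtype_lt {κ : Cardinal.{u}} (x : Iio κ.ord) :
    #(Iio x) < Cardinal.lift.{u + 1} κ := by
  have h : #(Iio x) ≤ #(Iio (x : Ordinal)) :=
    Cardinal.mk_le_of_injective (f := fun y ↦ ⟨y.1.1, y.2⟩) fun y z hyz ↦ by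
      simpa [Subtype.ext_iff] using hyz
  refine h.trans_lt ?_
  rw [Cardinal.mk_Iio_ordinal, Cardinal.lift_lt]
  exact Cardinal.lt_ord.1 x.2

theorem mk_Iic_subtype_lt {κ : Cardinal.{u}} (hκ : ℵ₀ ≤ κ) (x : Iio κ.ord) :
    #(Iic x) < Cardinal.lift.{u + 1} κ := by
  have hx := (Cardinal.isSuccLimit_ord hκ).succ_lt x.2
  refine (Cardinal.mk_le_mk_of_subset fun y (hy : y ≤ x) ↦ ?_).trans_lt
    (mk_Iio_subtype_lt ⟨_, hx⟩)
  exact lt_succ_of_le (α := Ordinal) hy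

/-! ### Sets that do not reflect fully -/

/-- The bound `i` exists separately at every `δ` closed under `f`, because `κ` has uncountable
cofinality; a single `i` works on a stationary set because there are fewer than `κ⁺` candidates. -/
theorem exists_isStationary_bounded {κ : Cardinal.{u}} (hκ : κ.IsRegular) (hκ₀ : ℵ₀ < κ)
    (d : Iio (succ κ).ord → ℕ → Iio (succ κ).ord)
    (hd : ∀ δ : Iio (succ κ).ord, (δ : Ordinal).cof = ℵ₀ → ∀ n, d δ n < δ)
    (h : Iio (succ κ).ord → Iio (succ κ).ord → Iio κ.ord)
    (f : Iio (succ κ).ord → Iio (succ κ).ord) :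
    ∃ i : Iio κ.ord, IsStationary {δ : Iio (succ κ).ord |
      (δ : Ordinal).cof = ℵ₀ ∧ ∀ n, f (d δ n) < δ ∧ h δ (f (d δ n)) < i} := by
  have hcof := cof_Iio_ord (Cardinal.isRegular_succ hκ.1)
  have hω : ℵ₀ < cof (Iio (succ κ).ord) := by
    rw [hcof, ← Cardinal.lift_aleph0.{u + 1, u}, Cardinal.lift_lt]
    exact hκ₀.trans (lt_succ κ)
  rw [← isStationary_iUnion_iff hω.ne']
  · refine (isStationary_cof_aleph0_closed hω (fun x ↦ ?_) f).mono fun δ hδ ↦ ?_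
    · rw [hcof]
      exact mk_Iic_subtype_lt (hκ.1.trans (le_succ κ)) x
    · obtain ⟨i, hi⟩ := exists_forall_lt_of_mk_lt_cof (s := range fun n ↦ h δ (f (d δ n)))
        ((Cardinal.le_aleph0_iff_set_countable.2 (countable_range _)).trans_lt (by
          rwa [cof_Iio_ord hκ, Cardinal.aleph0_lt_lift]))
      exact mem_iUnion.2 ⟨i, hδ.1, fun n ↦ ⟨hδ.2 _ (hd δ hδ.1 n), hi _ ⟨n, rfl⟩⟩⟩
  · simp [hcof, Cardinal.mk_Iio_ordinal]

/-- The theorem for the successor of an arbitrary regular `κ`, and sets of ordinals of a fixed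
uncountable cofinality `μ < κ`. -/
theorem exists_isStationary_not_reflectsFullyIn {κ μ : Cardinal.{u}} (hκ : κ.IsRegular)
    (hμ : ℵ₀ < μ) (hμκ : μ < κ) (A : Ordinal.{u} → Set Ordinal.{u})
    (hAμ : ∀ α < (succ κ).ord, ∀ γ ∈ A α, γ.cof = μ)
    (hA : ∀ α < (succ κ).ord, StationaryIn (succ κ).ord (A α)) :
    ∃ S : Set Ordinal.{u}, (∀ δ ∈ S, δ < (succ κ).ord ∧ δ.cof = ℵ₀) ∧
      StationaryIn (succ κ).ord S ∧ ∀ α < (succ κ).ord, ¬ ReflectsFullyIn (succ κ).ord S (A α) := by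
  set o := (succ κ).ord
  have hcof : cof (Iio o) = _ := cof_Iio_ord (Cardinal.isRegular_succ hκ.1)
  have hω : cof (Iio o) ≠ ℵ₀ := by
    rw [hcof, ne_eq, Cardinal.lift_eq_aleph0]
    exact ((hμ.trans hμκ).trans (lt_succ κ)).ne'
  have hmk : #(Iio o) = _ := mk_Iio_ord _
  have hω' : ℵ₀ ≤ #(Iio o) := by
    rw [hmk, Cardinal.aleph0_le_lift]
    exact hκ.1.trans (le_succ κ)
  have hne : Nonempty (Iio o) := Cardinal.mk_ne_zero_iff.1 (Cardinal.aleph0_pos.trans_le hω').ne'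
  have hneκ : Nonempty (Iio κ.ord) := ⟨0, by simpa using hκ.pos⟩
  have hIic (x : Iio o) : #(Iic x) < #(Iio o) := by
    rw [hmk]
    exact mk_Iic_subtype_lt (hκ.1.trans (le_succ κ)) x
  -- a cofinal `ω`-sequence `d δ` in every `δ` of countable cofinality
  have hd (δ : Iio o) : ∃ d : ℕ → Iio o, (δ : Ordinal).cof = ℵ₀ →
      (∀ n, d n < δ) ∧ ∀ b < δ, ∃ n, b ≤ d n := by
    by_cases hδ : (δ : Ordinal).cof = ℵ₀
    · obtain ⟨d, hdδ, hdb⟩ := exists_seq_of_cof_eq_aleph0 hδ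
      exact ⟨fun n ↦ ⟨d n, (hdδ n).trans δ.2⟩, fun _ ↦ ⟨hdδ, fun b hb ↦ hdb b hb⟩⟩
    · exact ⟨fun _ ↦ hne.some, fun h ↦ absurd h hδ⟩
  choose d hd using hd
  -- an injection `h δ` of `δ` into `κ`, for every `δ < κ⁺`
  have hh (δ : Iio o) : ∃ h : Iio o → Iio κ.ord, InjOn h (Iio δ) := by
    have : #(Iio δ) ≤ #(Iio κ.ord) := by
      rw [mk_Iio_ord, ← lt_succ_iff, ← Cardinal.lift_succ]
      exact mk_Iio_subtype_lt δ
    obtain ⟨e⟩ := this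
    classical
    refine ⟨fun x ↦ if hx : x < δ then e ⟨x, hx⟩ else hneκ.some, fun x hx y hy hxy ↦ ?_⟩
    simp only [mem_Iio] at hx hy
    simp only [hx, hy, dite_true] at hxy
    exact congrArg Subtype.val (e.injective hxy)
  choose h hh using hh
  obtain ⟨F, hF, hFne⟩ := exists_pairwise_eventually_ne hIic
  choose i hi using exists_isStationary_bounded hκ (hμ.trans hμκ) d (fun δ hδ ↦ (hd δ hδ).1) h
  let S : (Iio o → Iio o) → Set (Iio o) := fun f ↦
    {δ | (δ : Ordinal).cof = ℵ₀ ∧ ∀ n, f (d δ n) < δ ∧ h δ (f (d δ n)) < i f}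
  by_contra! hcon
  have hα (f : Iio o → Iio o) : ∃ α : Iio o, ReflectsFullyIn o (Subtype.val '' S f) (A α) := by
    obtain ⟨α, hα, hfα⟩ := hcon (Subtype.val '' S f)
      (by rintro _ ⟨δ, hδ, rfl⟩; exact ⟨δ.2, hδ.1⟩) ((hi f).mono fun δ hδ ↦ ⟨δ, hδ, rfl⟩)
    exact ⟨⟨α, hα⟩, hfα⟩
  choose α hα using hα
  obtain ⟨N, hNF, hNκ, a, j, hN⟩ : ∃ N ⊆ F, #N = Cardinal.lift.{u + 1} κ ∧
      ∃ a j, ∀ f ∈ N, α f = a ∧ i f = j := by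
    have hprod : #(Iio o × Iio κ.ord) = #(Iio o) := by
      rw [Cardinal.mk_prod, Cardinal.lift_id, Cardinal.lift_id, Cardinal.mul_eq_left hω']
      · rw [hmk, mk_Iio_ord, Cardinal.lift_le]
        exact le_succ κ
      · exact Cardinal.mk_ne_zero _
    obtain ⟨⟨a, j⟩, hfib⟩ := Cardinal.infinite_pigeonhole_card_lt
      (fun f : F ↦ (α f.1, i f.1)) (by rwa [hprod]) (hω'.trans hF.le)
    rw [hprod, hmk] at hfib
    obtain ⟨N, hN⟩ := Cardinal.le_mk_iff_exists_set.1
      ((Cardinal.lift_le.2 (le_succ κ)).trans hfib.le)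
    refine ⟨(fun f ↦ f.1.1) '' N, ?_, ?_, a, j, ?_⟩
    · rintro _ ⟨f, -, rfl⟩
      exact f.1.2
    · rw [← hN]
      exact Cardinal.mk_image_eq (Subtype.val_injective.comp Subtype.val_injective)
    · rintro _ ⟨f, -, rfl⟩
      exact Prod.mk.inj f.2
  -- from `β` on, any two members of `N` differ everywhere; `β` exists as `N × N` has size `κ`
  obtain ⟨β, hβ⟩ : ∃ β, ∀ f ∈ N, ∀ g ∈ N, f ≠ g → ∀ x, β ≤ x → f x ≠ g x := by
    choose! b hb using fun f (hf : f ∈ N) g (hg : g ∈ N) ↦ hFne (hNF hf) (hNF hg)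
    obtain ⟨β, hβ⟩ := exists_forall_lt_of_mk_lt_cof (s := range fun p : N × N ↦ b p.1 p.2) <| by
      refine Cardinal.mk_range_le.trans_lt ?_
      rw [Cardinal.mk_prod, Cardinal.lift_id, hNκ, ← Cardinal.lift_mul,
        Cardinal.mul_eq_self hκ.1, hcof, Cardinal.lift_lt]
      exact lt_succ κ
    exact ⟨β, fun f hf g hg hfg x hx ↦
      hb f hf g hg hfg x ((hβ _ ⟨(⟨f, hf⟩, ⟨g, hg⟩), rfl⟩).le.trans hx)⟩
  have hclub (f : N) : ∃ C : Set (Iio o), IsClub C ∧ ∀ γ ∈ C, (γ : Ordinal) ∈ A a →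
      ReflectsAt (Subtype.val '' S f) γ := by
    have := hα f
    rw [(hN f f.2).1, ReflectsFullyIn, StationaryIn, not_isStationary_iff] at this
    obtain ⟨C, hC, hdisj⟩ := this
    refine ⟨C, hC, fun γ hγ hγA ↦ ?_⟩
    by_contra hr
    exact disjoint_left.1 hdisj ⟨hγA, hr⟩ hγ
  choose C hC hCr using hclub
  have hnomax : NoMaxOrder (Iio o) := noMaxOrder_of_aleph0_le_cof <| by
    rwa [hcof, ← hmk]
  have hC' : IsClub ((⋂ f, C f) ∩ Ioi β) := by
    refine .inter hω (.iInter hω ?_ hC) (isClub_Ioi β)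
    rw [Cardinal.lift_id, Cardinal.lift_id, hNκ, hcof, Cardinal.lift_lt]
    exact lt_succ κ
  obtain ⟨γ, hγA, hγC, hβγ⟩ := hA a a.2 hC'
  have hγμ : cof (Iio (γ : Ordinal)) = Cardinal.lift.{u + 1} μ := by
    rw [Ordinal.cof_Iio, ← Ordinal.lift_cof, hAμ a a.2 γ hγA]
  have hnomax' : NoMaxOrder (Iio (γ : Ordinal)) := noMaxOrder_of_aleph0_le_cof <| by
    rw [hγμ, Cardinal.aleph0_le_lift]
    exact hμ.le
  obtain ⟨c, hc, hcμ⟩ := exists_isClub_mk_le_cof (Iio (γ : Ordinal))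
  rw [hγμ] at hcμ
  have hc' : IsClub (c ∩ Ioi ⟨β, hβγ⟩) := by
    refine hc.inter ?_ (isClub_Ioi _)
    rw [hγμ, ne_eq, Cardinal.lift_eq_aleph0]
    exact hμ.ne'
  have hmeet (f : N) : ∃ δ ∈ S f, β < δ ∧ ∃ x ∈ c, x.1 = δ := by
    obtain ⟨x, ⟨δ, hδ, hδx⟩, hxc, hβx⟩ := hCr f γ (mem_iInter.1 hγC f) hγA hc'
    exact ⟨δ, hδ, by rw [← Subtype.coe_lt_coe, hδx]; exact hβx, x, hxc, hδx.symm⟩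
  choose δ hδS hβδ x hxc hxδ using hmeet
  -- `n` depends on the point alone, not on `f`, so that equal points give equal arguments
  have hn (ε : Iio o) : ∃ n, (ε : Ordinal).cof = ℵ₀ → β < ε → β ≤ d ε n := by
    by_cases hε : (ε : Ordinal).cof = ℵ₀ ∧ β < ε
    · obtain ⟨n, hn⟩ := (hd ε hε.1).2 β hε.2
      exact ⟨n, fun _ _ ↦ hn⟩
    · exact ⟨0, fun h₁ h₂ ↦ absurd ⟨h₁, h₂⟩ hε⟩
  choose n hn using hn
  have hinj : Function.Injective fun f : N ↦
      ((⟨x f, hxc f⟩, ⟨h (δ f) (f.1 (d (δ f) (n (δ f)))),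
        (hN f f.2).2 ▸ ((hδS f).2 _).2⟩) : c × Iio j) := by
    intro f g hfg
    simp only [Prod.mk.injEq, Subtype.mk.injEq] at hfg
    have hδ : δ f = δ g := by
      rw [Subtype.ext_iff, ← hxδ, ← hxδ, hfg.1]
    by_contra hne
    refine hβ f f.2 g g.2 (Subtype.coe_ne_coe.2 hne) _ (hn _ (hδS f).1 (hβδ f)) ?_
    refine hh (δ f) ((hδS f).2 _).1 ?_ ?_
    · rw [hδ]
      exact ((hδS g).2 _).1
    · rw [hfg.2, hδ]
  refine (Cardinal.mk_le_of_injective hinj).not_gt ?_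
  rw [Cardinal.mk_prod, Cardinal.lift_id, Cardinal.lift_id, hNκ]
  refine Cardinal.mul_lt_of_lt ?_ (hcμ.trans_lt (Cardinal.lift_lt.2 hμκ)) (mk_Iio_subtype_lt j)
  rw [Cardinal.aleph0_le_lift]
  exact hκ.1

end StationaryReflection

theorem proposition3p1 (A : Ordinal.{u} → Set Ordinal.{u})
    (hA : ∀ α < ω_ 3, A α ⊆ StationaryReflection.cofSet 3 1 ∧
      StationaryReflection.StationaryIn (ω_ 3) (A α)) :
    ∃ S : Set Ordinal.{u}, S ⊆ StationaryReflection.cofSet 3 0 ∧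
      StationaryReflection.StationaryIn (ω_ 3) S ∧
      ∀ α < ω_ 3, ¬ StationaryReflection.ReflectsFullyIn (ω_ 3) S (A α) := by
  have h12 : (1 : Ordinal.{u}) + 1 = 2 := by norm_num
  have h23 : (2 : Ordinal.{u}) + 1 = 3 := by norm_num
  have h3 : (Order.succ (ℵ_ 2 : Cardinal.{u})).ord = ω_ 3 := by
    rw [Cardinal.succ_aleph, h23, Cardinal.ord_aleph]
  have hreg : (ℵ_ 2 : Cardinal.{u}).IsRegular := h12 ▸ Cardinal.isRegular_aleph_add_one 1
  obtain ⟨S, hS, hSst, hSA⟩ := StationaryReflection.exists_isStationary_not_reflectsFullyIn hreg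
    (μ := ℵ_ 1) (by simp) (by simp) A
    (fun α hα γ hγ ↦ by simpa using ((hA α (h3 ▸ hα)).1 hγ).2)
    (fun α hα ↦ h3 ▸ (hA α (h3 ▸ hα)).2)
  rw [h3] at hS hSst hSA
  exact ⟨S, fun δ hδ ↦ by simpa [StationaryReflection.cofSet] using hS δ hδ, hSst, hSA⟩
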